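/- Let $H^2$ be the Hardy space of the unit disk $\mathbb{D}$, identified through boundary values with a closed subspace of $L^2(\partial\mathbb{D})$ (normalized arc length, with inner product $\langle\cdot,\cdot\rangle$). For a finite Blaschke product $\alpha$ let $K_\alpha=H^2\ominus\alpha H^2$, let $P_\alpha$ be the orthogonal projection of $L^2(\partial\mathbb{D})$ onto $K_\alpha$, and let $$k_0^\alpha(z)=1-\overline{\alpha(0)}\,\alpha(z),\qquad \widetilde{k}_0^\alpha(z)=\frac{\alpha(z)-\alpha(0)}{z},$$ both of which belong to $K_\alpha$. Write $(f\otimes g)(h)=\langle h,g\rangle f$. The compressed shift is $S_\alpha f=P_\alpha(zf)$, $f\in K_\alpha$, and for $c\in\mathbb{C}$ the modified compressed shift is $S_{\alpha,c}=S_\alpha+c\,(k_0^\alpha\otimes\widetilde{k}_0^\alpha)$. For finite Blaschke products $\alpha,\beta$ let $\mathscr{T}(\alpha,\beta)$ be the set of asymmetric truncated Toeplitz operators, that is, of all bounded operators $A_\varphi^{\alpha,\beta}\colon K_\alpha\to K_\beta$, $A_\varphi^{\alpha,\beta}f=P_\beta(\varphi f)$, with $\varphi\in L^2(\partial\mathbb{D})$.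 Theorem. Let $\alpha,\beta$ be finite Blaschke products and let $a,b\in\mathbb{C}$. A linear operator $A\colon K_\alpha\to K_\beta$ belongs to $\mathscr{T}(\alpha,\beta)$ if and only if there are functions $\chi\in K_\alpha$ and $\psi\in K_\beta$ such that $$A-S_{\beta,b}\,A\,S_{\alpha,a}^{*}=\psi\otimes k_0^\alpha+k_0^\beta\otimes\chi .$$ -/

import Mathlib

open MeasureTheory AddCircle
open scoped ComplexConjugate ENNReal

noncomputable section

/-- The Lebesgue space `L²(∂𝔻)` with respect to normalized arc length. The circle is parametrized
by `t ↦ exp (2 π i t)`, `t ∈ ℝ/ℤ`. -/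
abbrev L2Circle : Type := Lp ℂ 2 (haarAddCircle (T := 1))

/-- The Hardy space `H²`, identified via boundary values with the subspace of `L²(∂𝔻)` of
functions all of whose Fourier coefficients of negative index vanish. -/
def hardySpace : Submodule ℂ L2Circle where
  carrier := {f | ∀ n : ℤ, n < 0 → fourierCoeff f n = 0}
  zero_mem' := by
    intro n _
    rw [← fourierBasis_repr]; simp
  add_mem' := by
    intro f g hf hg n hn
    have h1 := hf n hn
    have h2 := hg n hn
    rw [← fourierBasis_repr] at h1 h2 ⊢
    simp [h1, h2]
  smul_mem' := by
    intro c f hf n hn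
    have h1 := hf n hn
    rw [← fourierBasis_repr] at h1 ⊢
    simp [h1]

theorem mem_hardySpace_iff (f : L2Circle) :
    f ∈ hardySpace ↔ ∀ n : ℤ, n < 0 → fourierCoeff f n = 0 := Iff.rfl

theorem fourierCoeff_eq_inner (f : L2Circle) (n : ℤ) :
    fourierCoeff f n = inner ℂ (fourierLp (T := 1) 2 n) f := by
  rw [← fourierBasis_repr, HilbertBasis.repr_apply_apply, coe_fourierBasis]

theorem isClosed_hardySpace : IsClosed (hardySpace : Set L2Circle) := by
  have : (hardySpace : Set L2Circle) =
      ⋂ n : ℤ, ⋂ _ : n < 0, {f : L2Circle | inner ℂ (fourierLp (T := 1) 2 n) f = 0} := by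
    ext f
    simp [mem_hardySpace_iff, fourierCoeff_eq_inner]
  rw [this]
  exact isClosed_iInter fun n => isClosed_iInter fun _ =>
    isClosed_eq (continuous_const.inner continuous_id) continuous_const

/-- Multiplication by a continuous function on `L²(∂𝔻)`. -/
def mulOp (g : C(AddCircle (1 : ℝ), ℂ)) : L2Circle →L[ℂ] L2Circle :=
  (ContinuousLinearMap.mul ℂ ℂ).holderL haarAddCircle ∞ 2 2
    (ContinuousMap.toLp ∞ haarAddCircle ℂ g)

theorem coeFn_mulOp (g : C(AddCircle (1 : ℝ), ℂ)) (f : L2Circle) :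
    mulOp g f =ᵐ[haarAddCircle] fun t => g t * f t := by
  have h1 := (ContinuousLinearMap.mul ℂ ℂ).coeFn_holder (r := 2)
    (ContinuousMap.toLp ∞ haarAddCircle ℂ g) f
  have h2 := ContinuousMap.coeFn_toLp (p := ∞) (𝕜 := ℂ) haarAddCircle g
  refine Filter.EventuallyEq.trans h1 ?_
  filter_upwards [h2] with t ht
  rw [ContinuousLinearMap.mul_apply', ht]

theorem continuous_coe_toCircle : Continuous fun t : AddCircle (1 : ℝ) => (toCircle t : ℂ) :=
  (fourier (T := 1) 1).continuous.congr fun _ => fourier_one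

theorem fourierCoeff_boundary {F : ℂ → ℂ} (hF : ∀ z, ‖z‖ ≤ 1 → DifferentiableAt ℂ F z) (k : ℕ) :
    fourierCoeff (fun t : AddCircle (1 : ℝ) => F (toCircle t)) (-(k : ℤ)) = 0 ^ k * F 0 := by
  have hd : DiffContOnCl ℂ (fun z => z ^ k * F z) (Metric.ball 0 |1|) := by
    refine DifferentiableOn.diffContOnCl fun z hz => ?_
    have hz' : ‖z‖ ≤ 1 := by
      rw [abs_one, closure_ball _ one_ne_zero] at hz
      simpa using hz
    exact ((differentiableAt_id.pow k).mul (hF z hz')).differentiableWithinAt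
  rw [← hd.circleAverage, fourierCoeff_eq_intervalIntegral _ _ 0, Real.circleAverage]
  have h := intervalIntegral.smul_integral_comp_mul_left (a := 0) (b := 1)
    (fun θ => circleMap 0 1 θ ^ k * F (circleMap 0 1 θ)) (2 * Real.pi)
  rw [mul_zero, mul_one] at h
  rw [← h, smul_smul, inv_mul_cancel₀ Real.two_pi_pos.ne']
  simp only [div_one, zero_add]
  congr 1
  refine intervalIntegral.integral_congr fun x _ => ?_
  have hx : (toCircle (x : AddCircle (1 : ℝ)) : ℂ) = circleMap 0 1 (2 * Real.pi * x) := by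
    simp [toCircle_apply_mk, circleMap]
  simp only [neg_neg, smul_eq_mul]
  rw [fourier_apply, toCircle_zsmul, Circle.coe_zpow, hx, zpow_natCast]

theorem toLp_mem_hardySpace {g : C(AddCircle (1 : ℝ), ℂ)}
    (hg : ∀ k : ℕ, 0 < k → fourierCoeff g (-(k : ℤ)) = 0) :
    ContinuousMap.toLp 2 haarAddCircle ℂ g ∈ hardySpace := by
  intro n hn
  rw [fourierCoeff_toLp]
  obtain ⟨k, hk⟩ := Int.eq_ofNat_of_zero_le (neg_nonneg.mpr hn.le)
  rw [show n = -(k : ℤ) by omega]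
  exact hg k (by omega)

theorem toLp_inner_mulOp {g u : C(AddCircle (1 : ℝ), ℂ)} {G : ℂ → ℂ}
    (hG : ∀ z, ‖z‖ ≤ 1 → DifferentiableAt ℂ G z) (hG0 : G 0 = 0)
    (hgu : ∀ t, conj (g t) * u t = G (toCircle t)) {f : L2Circle} (hf : f ∈ hardySpace) :
    inner ℂ (ContinuousMap.toLp 2 haarAddCircle ℂ g) (mulOp u f) = 0 := by
  have h1 : inner ℂ (ContinuousMap.toLp 2 haarAddCircle ℂ g) (mulOp u f) =
      inner ℂ (ContinuousMap.toLp 2 haarAddCircle ℂ (g * star u)) f := by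
    rw [L2.inner_def, L2.inner_def]
    refine integral_congr_ae ?_
    filter_upwards [coeFn_mulOp u f, ContinuousMap.coeFn_toLp (p := 2) (𝕜 := ℂ) haarAddCircle g,
      ContinuousMap.coeFn_toLp (p := 2) (𝕜 := ℂ) haarAddCircle (g * star u)] with t h2 h3 h4
    rw [h2, h3, h4]
    simp
    ring
  rw [h1, ← fourierBasis.tsum_inner_mul_inner]
  refine (tsum_congr fun j => ?_).trans tsum_zero
  rw [coe_fourierBasis, ← fourierCoeff_eq_inner]
  rcases lt_or_ge j 0 with hj | hj
  · rw [hf j hj, mul_zero]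
  · obtain ⟨k, rfl⟩ := Int.eq_ofNat_of_zero_le hj
    have h2 := fourierCoeff_boundary hG k
    rw [hG0, mul_zero] at h2
    convert zero_mul _ using 2
    rw [← h2, L2.inner_def, fourierCoeff]
    refine integral_congr_ae ?_
    filter_upwards [ContinuousMap.coeFn_toLp (p := 2) (𝕜 := ℂ) haarAddCircle (g * star u),
      coeFn_fourierLp (T := 1) 2 (k : ℤ)] with t h3 h4
    rw [h3, h4, ← hgu]
    simp

/-- A finite Blaschke product
`α(z) = c ∏ⱼ (z - aⱼ) / (1 - conj aⱼ z)`, `|c| = 1`, `|aⱼ| < 1`. -/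
structure FiniteBlaschkeProduct where
  degree : ℕ
  const : ℂ
  norm_const : ‖const‖ = 1
  zero : Fin degree → ℂ
  norm_zero_lt : ∀ j, ‖zero j‖ < 1

namespace FiniteBlaschkeProduct

variable (α β : FiniteBlaschkeProduct)

/-- The value `α(z)`, for `z` in the closed unit disk. -/
def eval (z : ℂ) : ℂ :=
  α.const * ∏ j, (z - α.zero j) / (1 - conj (α.zero j) * z)

theorem denom_ne_zero {z : ℂ} (hz : ‖z‖ ≤ 1) (j : Fin α.degree) :
    1 - conj (α.zero j) * z ≠ 0 := by
  intro h
  have h1 : ‖conj (α.zero j) * z‖ = 1 := by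
    rw [← sub_eq_zero.mp h]; simp
  rw [norm_mul, RCLike.norm_conj] at h1
  have := α.norm_zero_lt j
  nlinarith [norm_nonneg z, norm_nonneg (α.zero j)]

theorem differentiableAt_eval {z : ℂ} (hz : ‖z‖ ≤ 1) : DifferentiableAt ℂ α.eval z := by
  unfold eval
  refine (DifferentiableAt.fun_finsetProd fun j _ => ?_).const_mul _
  exact (by fun_prop : DifferentiableAt ℂ (fun z => z - α.zero j) z).div (by fun_prop)
    (α.denom_ne_zero hz j)

theorem norm_eval {z : ℂ} (hz : ‖z‖ = 1) : ‖α.eval z‖ = 1 := by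
  have key : ∀ j, ‖(z - α.zero j) / (1 - conj (α.zero j) * z)‖ = 1 := by
    intro j
    have h0 := α.denom_ne_zero hz.le j
    rw [norm_div, div_eq_one_iff_eq (norm_ne_zero_iff.mpr h0)]
    have hzz : conj z * z = 1 := by
      rw [Complex.conj_mul', hz]; simp
    have : 1 - conj (α.zero j) * z = conj (z - α.zero j) * z := by
      rw [map_sub, sub_mul, hzz]
    rw [this, norm_mul, RCLike.norm_conj, hz, mul_one]
  rw [eval, norm_mul, α.norm_const, norm_prod, Finset.prod_congr rfl fun j _ => key j]
  simp

/-- The boundary function of `α` on the unit circle. -/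
def boundary : C(AddCircle (1 : ℝ), ℂ) where
  toFun t := α.eval (toCircle t)
  continuous_toFun := by
    rw [continuous_iff_continuousAt]
    intro t
    exact ContinuousAt.comp (g := α.eval) (f := fun t : AddCircle (1 : ℝ) => (toCircle t : ℂ))
      (α.differentiableAt_eval (Circle.norm_coe _).le).continuousAt continuous_coe_toCircle.continuousAt

theorem boundary_apply (t : AddCircle (1 : ℝ)) : α.boundary t = α.eval (toCircle t) := rfl

/-- The model space `K_α = H² ⊖ α H²`. -/
def modelSpace : Submodule ℂ L2Circle :=
  hardySpace ⊓ (hardySpace.map (mulOp α.boundary : L2Circle →ₗ[ℂ] L2Circle))ᗮ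

instance : CompleteSpace α.modelSpace :=
  (isClosed_hardySpace.inter (Submodule.isClosed_orthogonal _)).completeSpace_coe

theorem toLp_mem_modelSpace {g : C(AddCircle (1 : ℝ), ℂ)} {G : ℂ → ℂ}
    (hg : ∀ k : ℕ, 0 < k → fourierCoeff g (-(k : ℤ)) = 0)
    (hG : ∀ z, ‖z‖ ≤ 1 → DifferentiableAt ℂ G z) (hG0 : G 0 = 0)
    (hgu : ∀ t, conj (g t) * α.boundary t = G (toCircle t)) :
    ContinuousMap.toLp 2 haarAddCircle ℂ g ∈ α.modelSpace := by
  refine Submodule.mem_inf.mpr ⟨toLp_mem_hardySpace hg, ?_⟩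
  rw [Submodule.mem_orthogonal']
  rintro _ ⟨f, hf, rfl⟩
  exact toLp_inner_mulOp hG hG0 hgu hf

theorem conj_boundary_mul (t : AddCircle (1 : ℝ)) :
    conj (α.boundary t) * α.boundary t = 1 := by
  rw [Complex.conj_mul', boundary_apply, α.norm_eval (Circle.norm_coe _)]
  simp

theorem conj_toCircle_mul (t : AddCircle (1 : ℝ)) :
    conj (toCircle t : ℂ) * toCircle t = 1 := by
  rw [Complex.conj_mul', Circle.norm_coe]
  simp

/-- The boundary values of `k₀^α(z) = 1 - conj (α(0)) α(z)`. -/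
def kernelFun : C(AddCircle (1 : ℝ), ℂ) where
  toFun t := 1 - conj (α.eval 0) * α.eval (toCircle t)
  continuous_toFun := continuous_const.sub (continuous_const.mul α.boundary.continuous)

/-- The boundary values of the conjugate kernel `(α(z) - α(0)) / z`. -/
def conjKernelFun : C(AddCircle (1 : ℝ), ℂ) where
  toFun t := (α.eval (toCircle t) - α.eval 0) / toCircle t
  continuous_toFun := (α.boundary.continuous.sub continuous_const).div
    continuous_coe_toCircle fun _ => Circle.coe_ne_zero _

theorem kernelFun_apply (t : AddCircle (1 : ℝ)) :
    α.kernelFun t = 1 - conj (α.eval 0) * α.eval (toCircle t) := rfl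

theorem conjKernelFun_apply (t : AddCircle (1 : ℝ)) :
    α.conjKernelFun t = (α.eval (toCircle t) - α.eval 0) / toCircle t := rfl

/-- The kernel function `k₀^α`, as an element of `K_α`. -/
def kernel : α.modelSpace :=
  ⟨ContinuousMap.toLp 2 haarAddCircle ℂ α.kernelFun, by
    refine α.toLp_mem_modelSpace (G := fun z => α.eval z - α.eval 0) ?_ ?_ ?_ ?_
    · intro k hk
      have h := fourierCoeff_boundary (F := fun z => 1 - conj (α.eval 0) * α.eval z)
        (fun z hz => (differentiableAt_const _).sub ((α.differentiableAt_eval hz).const_mul _)) k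
      rwa [zero_pow hk.ne', zero_mul] at h
    · exact fun z hz => (α.differentiableAt_eval hz).sub_const _
    · simp
    · intro t
      have h := α.conj_boundary_mul t
      simp only [boundary_apply, kernelFun_apply, map_sub, map_one, map_mul,
        Complex.conj_conj] at h ⊢
      linear_combination (-α.eval 0) * h⟩

/-- The conjugate kernel function of `K_α` at `0`, as an element of `K_α`. -/
def conjKernel : α.modelSpace :=
  ⟨ContinuousMap.toLp 2 haarAddCircle ℂ α.conjKernelFun, by
    refine α.toLp_mem_modelSpace (G := fun z => z * (1 - conj (α.eval 0) * α.eval z)) ?_ ?_ ?_ ?_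
    · intro k hk
      have h := fourierCoeff_boundary (F := fun z => α.eval z - α.eval 0)
        (fun z hz => (α.differentiableAt_eval hz).sub_const _) (k - 1)
      rw [sub_self, mul_zero] at h
      rw [← h, fourierCoeff, fourierCoeff]
      refine integral_congr_ae (Filter.Eventually.of_forall fun t => ?_)
      have hk' : -(-(k : ℤ)) = -(-((k - 1 : ℕ) : ℤ)) + 1 := by omega
      have ht : (toCircle t : ℂ) ≠ 0 := Circle.coe_ne_zero _
      simp only [hk', fourier_add, fourier_one, conjKernelFun_apply, smul_eq_mul]
      field_simp
    · exact fun z hz => differentiableAt_id.mul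
        ((differentiableAt_const _).sub ((α.differentiableAt_eval hz).const_mul _))
    · simp
    · intro t
      have h := α.conj_boundary_mul t
      have h' := conj_toCircle_mul t
      have hz : conj (toCircle t : ℂ) ≠ 0 := left_ne_zero_of_mul (h' ▸ one_ne_zero)
      simp only [boundary_apply, conjKernelFun_apply, map_sub, map_div₀] at h ⊢
      rw [div_mul_eq_mul_div, div_eq_iff hz]
      linear_combination h -
        (1 - conj (α.eval 0) * α.eval (toCircle t)) * h'⟩

/-- The compressed shift `S_α f = P_α (z f)` on `K_α`. -/
def compressedShift : α.modelSpace →L[ℂ] α.modelSpace :=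
  α.modelSpace.orthogonalProjectionOnto ∘L mulOp (fourier 1) ∘L α.modelSpace.subtypeL

/-- The modified compressed shift `S_{α,c} = S_α + c (k₀^α ⊗ k̃₀^α)`, where
`(f ⊗ g) h = ⟨h, g⟩ f` is `InnerProductSpace.rankOne ℂ f g`. -/
def modifiedShift (c : ℂ) : α.modelSpace →L[ℂ] α.modelSpace :=
  α.compressedShift + c • InnerProductSpace.rankOne ℂ α.kernel α.conjKernel

/-- The set `𝒯(α, β)` of asymmetric truncated Toeplitz operators: the bounded operators
`f ↦ P_β (φ f)`, `f ∈ K_α`, with symbol `φ ∈ L²(∂𝔻)`. -/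
def asymTruncToeplitz : Set (α.modelSpace →ₗ[ℂ] β.modelSpace) :=
  {A | Continuous A ∧ ∃ φ : L2Circle, ∀ f : α.modelSpace,
    ∃ h : MemLp (fun t => φ t * (f : L2Circle) t) 2 haarAddCircle,
      A f = β.modelSpace.orthogonalProjectionOnto (h.toLp _)}

end FiniteBlaschkeProduct

end

/-!
The displacement `A ↦ A - S_β A S_α^*` sends the truncated Toeplitz operator with symbol `φ` to
`(P_β φ - φ̂(0) k₀^β) ⊗ k₀^α + k₀^β ⊗ P_α φ̄`, because `S_α^*` is the backward shift, which differs
from multiplication by `z̄` only by the constant term. In particular the symbols `ψ ∈ K_β` and `χ̄`,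
`χ ∈ K_α`, have displacements `ψ ⊗ k₀^α` and `k₀^β ⊗ χ`, so every operator of the form
`ψ ⊗ k₀^α + k₀^β ⊗ χ` is the displacement of a truncated Toeplitz operator. The displacement is
injective, since `S_β` is a contraction and the powers of the backward shift tend strongly to zero;
this settles `a = b = 0`. Perturbing `S_α` and `S_β` by operators with range in the span of `k₀^α`
and of `k₀^β` moves the displacement only within the operators `ψ ⊗ k₀^α + k₀^β ⊗ χ`.
-/

noncomputable section

open Filter InnerProductSpace Topology

section Displacement

variable {𝕜 E F : Type*}

section NormedSpace

variable [NontriviallyNormedField 𝕜] [NormedAddCommGroup E] [NormedSpace 𝕜 E]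
  [NormedAddCommGroup F] [NormedSpace 𝕜 F]

/-- The displacement `A ↦ A - S A R` of operators `A : E → F`, where `R` plays the role of the
adjoint in `A - S A T^*`. -/
def displacement (S : F →L[𝕜] F) (R : E →L[𝕜] E) : (E →L[𝕜] F) →ₗ[𝕜] (E →L[𝕜] F) where
  toFun A := A - S ∘L A ∘L R
  map_add' A B := by
    ext x
    simp only [ContinuousLinearMap.comp_apply, sub_apply, add_apply, map_add]
    abel
  map_smul' c A := by
    ext x
    simp only [ContinuousLinearMap.comp_apply, sub_apply, smul_apply, map_smul, smul_sub,
      RingHom.id_apply]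

theorem displacement_apply (S : F →L[𝕜] F) (R : E →L[𝕜] E) (A : E →L[𝕜] F) :
    displacement S R A = A - S ∘L A ∘L R := rfl

theorem displacement_injective {S : F →L[𝕜] F} {R : E →L[𝕜] E} (hS : ‖S‖ ≤ 1)
    (hR : ∀ x, Tendsto (fun n => R^[n] x) atTop (𝓝 0)) :
    Function.Injective (displacement S R) := by
  rw [injective_iff_map_eq_zero]
  intro A hA
  have norm_le (x : E) : ‖A x‖ ≤ ‖A (R x)‖ := by
    have hAx : A x = S (A (R x)) := DFunLike.congr_fun (sub_eq_zero.mp hA) x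
    exact hAx ▸ S.le_of_opNorm_le_of_le hS le_rfl |>.trans_eq (one_mul _)
  have norm_le_iterate (n : ℕ) : ∀ x, ‖A x‖ ≤ ‖A (R^[n] x)‖ := by
    induction n with
    | zero => exact fun x => le_rfl
    | succ n ih => exact fun x => (norm_le x).trans (ih (R x))
  ext x
  have hlim : Tendsto (fun n => ‖A (R^[n] x)‖) atTop (𝓝 0) := by
    simpa using ((A.continuous.tendsto 0).comp (hR x)).norm
  exact norm_le_zero_iff.mp (ge_of_tendsto' hlim fun n => norm_le_iterate n x)

end NormedSpace

section InnerProductSpace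

variable [RCLike 𝕜] [NormedAddCommGroup E] [InnerProductSpace 𝕜 E]
  [NormedAddCommGroup F] [InnerProductSpace 𝕜 F]

variable (𝕜) in
/-- The operators `ψ ⊗ k + l ⊗ χ` with `ψ ∈ F` and `χ ∈ E`, the form taken by the displacements of
truncated Toeplitz operators. -/
def rankOneSum (k : E) (l : F) : Submodule 𝕜 (E →L[𝕜] F) where
  carrier := {B | ∃ (χ : E) (ψ : F), B = rankOne 𝕜 ψ k + rankOne 𝕜 l χ}
  zero_mem' := ⟨0, 0, by simp⟩
  add_mem' := by
    rintro _ _ ⟨χ, ψ, rfl⟩ ⟨χ', ψ', rfl⟩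
    refine ⟨χ + χ', ψ + ψ', ?_⟩
    simp only [map_add, add_apply]
    abel
  smul_mem' := by
    rintro c _ ⟨χ, ψ, rfl⟩
    refine ⟨conj c • χ, c • ψ, ?_⟩
    simp only [map_smul, map_smulₛₗ, smul_apply, smul_add, RCLike.conj_conj]

theorem mem_rankOneSum {k : E} {l : F} {B : E →L[𝕜] F} :
    B ∈ rankOneSum 𝕜 k l ↔ ∃ (χ : E) (ψ : F), B = rankOne 𝕜 ψ k + rankOne 𝕜 l χ := Iff.rfl

theorem rankOne_sub_smul_add_rankOne_conj_smul (x l : F) (k : E) (c : 𝕜) :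
    rankOne 𝕜 (x - c • l) k + rankOne 𝕜 l (conj c • k) = rankOne 𝕜 x k := by
  simp only [map_sub, map_smul, map_smulₛₗ, RCLike.conj_conj, sub_apply, smul_apply,
    sub_add_cancel]

variable [CompleteSpace E] [CompleteSpace F]

theorem displacement_add_rankOne_mem_rankOneSum_iff (S : F →L[𝕜] F) (T : E →L[𝕜] E) (k u : E)
    (l v : F) (A : E →L[𝕜] F) :
    displacement (S + rankOne 𝕜 l v) (ContinuousLinearMap.adjoint (T + rankOne 𝕜 k u)) A ∈
        rankOneSum 𝕜 k l ↔
      displacement S (ContinuousLinearMap.adjoint T) A ∈ rankOneSum 𝕜 k l := by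
  have hdiff :
      displacement (S + rankOne 𝕜 l v) (ContinuousLinearMap.adjoint (T + rankOne 𝕜 k u)) A =
        displacement S (ContinuousLinearMap.adjoint T) A -
          (rankOne 𝕜 ((S + rankOne 𝕜 l v) (A u)) k +
            rankOne 𝕜 l (ContinuousLinearMap.adjoint (A ∘L ContinuousLinearMap.adjoint T) v)) := by
    simp only [map_add, adjoint_rankOne, displacement_apply, ContinuousLinearMap.add_comp,
      ContinuousLinearMap.comp_add, comp_rankOne, rankOne_comp]
    abel
  rw [hdiff]
  exact Submodule.sub_mem_iff_left _ ⟨_, _, rfl⟩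

end InnerProductSpace

end Displacement

section Multiplication

theorem mulOp_toLp (g h : C(AddCircle (1 : ℝ), ℂ)) :
    mulOp g (ContinuousMap.toLp 2 haarAddCircle ℂ h) =
      ContinuousMap.toLp 2 haarAddCircle ℂ (g * h) := by
  refine Lp.ext ?_
  filter_upwards [coeFn_mulOp g (ContinuousMap.toLp 2 haarAddCircle ℂ h),
    ContinuousMap.coeFn_toLp (p := 2) (𝕜 := ℂ) haarAddCircle h,
    ContinuousMap.coeFn_toLp (p := 2) (𝕜 := ℂ) haarAddCircle (g * h)] with t hmul hh hgh
  rw [hmul, hh, hgh, ContinuousMap.mul_apply]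

theorem mulOp_mulOp (g h : C(AddCircle (1 : ℝ), ℂ)) (f : L2Circle) :
    mulOp g (mulOp h f) = mulOp (g * h) f := by
  refine Lp.ext ?_
  filter_upwards [coeFn_mulOp g (mulOp h f), coeFn_mulOp h f, coeFn_mulOp (g * h) f]
    with t hg hh hgh
  rw [hg, hh, hgh, ContinuousMap.mul_apply, mul_assoc]

theorem mulOp_one (f : L2Circle) : mulOp 1 f = f := by
  refine Lp.ext ?_
  filter_upwards [coeFn_mulOp 1 f] with t ht
  rw [ht, ContinuousMap.one_apply, one_mul]

/-- The assignment `g ↦ mulOp g` as a continuous linear map, so that a product `g f` can be studied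
as a function of the continuous factor `g`. -/
def mulOpL : C(AddCircle (1 : ℝ), ℂ) →L[ℂ] L2Circle →L[ℂ] L2Circle :=
  (ContinuousLinearMap.mul ℂ ℂ).holderL haarAddCircle ∞ 2 2 ∘L
    ContinuousMap.toLp ∞ haarAddCircle ℂ

theorem mulOpL_apply (g : C(AddCircle (1 : ℝ), ℂ)) : mulOpL g = mulOp g := rfl

theorem inner_mulOp_left (g : C(AddCircle (1 : ℝ), ℂ)) (u v : L2Circle) :
    inner ℂ (mulOp g u) v = inner ℂ u (mulOp (star g) v) := by
  rw [L2.inner_def, L2.inner_def]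
  refine integral_congr_ae ?_
  filter_upwards [coeFn_mulOp g u, coeFn_mulOp (star g) v] with t hu hv
  simp only [hu, hv, RCLike.inner_apply, map_mul, ContinuousMap.star_apply, RCLike.star_def]
  ring

theorem inner_mulOp_right (g : C(AddCircle (1 : ℝ), ℂ)) (u v : L2Circle) :
    inner ℂ u (mulOp g v) = inner ℂ (mulOp (star g) u) v := by
  rw [inner_mulOp_left, star_star]

theorem norm_mulOp_of_norm_eq_one {g : C(AddCircle (1 : ℝ), ℂ)} (hg : ∀ t, ‖g t‖ = 1)
    (f : L2Circle) : ‖mulOp g f‖ = ‖f‖ := by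
  rw [Lp.norm_def, Lp.norm_def]
  refine congrArg ENNReal.toReal (eLpNorm_congr_norm_ae ?_)
  filter_upwards [coeFn_mulOp g f] with t ht
  rw [ht, norm_mul, hg, one_mul]

end Multiplication

section FourierCoefficients

theorem star_fourier (n : ℤ) : star (fourier (T := (1 : ℝ)) n) = fourier (-n) := by
  ext t
  rw [fourier_neg, ContinuousMap.star_apply, RCLike.star_def]

theorem fourier_mul_fourier (m n : ℤ) :
    fourier (T := (1 : ℝ)) m * fourier n = fourier (m + n) := by
  ext t
  rw [fourier_add, ContinuousMap.mul_apply]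

theorem fourier_zero_eq_one : fourier (T := (1 : ℝ)) 0 = 1 := by
  ext t
  rw [fourier_zero, ContinuousMap.one_apply]

theorem fourier_eq_toCircle_zpow (n : ℤ) (t : AddCircle (1 : ℝ)) :
    fourier n t = (toCircle t : ℂ) ^ n := by
  rw [fourier_apply, toCircle_zsmul, Circle.coe_zpow]

theorem mulOp_fourierLp (g : C(AddCircle (1 : ℝ), ℂ)) (n : ℤ) :
    mulOp g (fourierLp (T := 1) 2 n) = ContinuousMap.toLp 2 haarAddCircle ℂ (g * fourier n) :=
  mulOp_toLp g (fourier n)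

theorem fourierCoeff_fourierLp (m : ℤ) :
    fourierCoeff (fourierLp (T := 1) 2 m) = Pi.single m 1 := by
  ext n
  rw [fourierLp, fourierCoeff_toLp, fourierCoeff_fourier]

theorem fourierCoeff_mulOp_fourier (m n : ℤ) (f : L2Circle) :
    fourierCoeff (mulOp (fourier m) f) n = fourierCoeff f (n - m) := by
  rw [fourierCoeff_eq_inner, inner_mulOp_right, star_fourier, mulOp_fourierLp,
    fourier_mul_fourier, neg_add_eq_sub, fourierCoeff_eq_inner]

theorem fourierCoeff_star (f : L2Circle) (n : ℤ) :
    fourierCoeff (star f : L2Circle) n = conj (fourierCoeff f (-n)) := by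
  rw [fourierCoeff, fourierCoeff, ← integral_conj]
  refine integral_congr_ae ?_
  filter_upwards [Lp.coeFn_star f] with t ht
  simp only [ht, Pi.star_apply, RCLike.star_def, smul_eq_mul, map_mul, fourier_neg, neg_neg]

theorem fourierCoeff_zero_mulOp (g : C(AddCircle (1 : ℝ), ℂ)) (f : L2Circle) :
    fourierCoeff (mulOp g f) 0 =
      inner ℂ (star f : L2Circle) (ContinuousMap.toLp 2 haarAddCircle ℂ g) := by
  rw [fourierCoeff, L2.inner_def]
  refine integral_congr_ae ?_
  filter_upwards [coeFn_mulOp g f, Lp.coeFn_star f,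
    ContinuousMap.coeFn_toLp (p := 2) (𝕜 := ℂ) haarAddCircle g] with t hgf hf hg
  simp only [hgf, hf, hg, neg_zero, fourier_zero, one_smul, Pi.star_apply, RCLike.star_def,
    RCLike.inner_apply, RCLike.conj_conj]

theorem hasSum_sq_norm_fourierCoeff (f : L2Circle) :
    HasSum (fun n : ℤ => ‖fourierCoeff f n‖ ^ 2) (‖f‖ ^ 2) := by
  simpa [fourierBasis_repr] using lp.hasSum_norm (by norm_num) (fourierBasis.repr f)

theorem eq_sum_fourierLp_of_fourierCoeff_eq_zero {f : L2Circle} {s : Finset ℤ}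
    (hf : ∀ n ∉ s, fourierCoeff f n = 0) :
    f = ∑ n ∈ s, fourierCoeff f n • fourierLp (T := 1) 2 n :=
  (hasSum_fourier_series_L2 f).unique <|
    hasSum_sum_of_ne_finset_zero fun n hn => by rw [hf n hn, zero_smul]

end FourierCoefficients

section HardySpace

theorem inner_fourierLp_right_of_mem_hardySpace {f : L2Circle} (hf : f ∈ hardySpace) {n : ℤ}
    (hn : n < 0) : inner ℂ f (fourierLp (T := 1) 2 n) = 0 := by
  rw [← inner_conj_symm, ← fourierCoeff_eq_inner, hf n hn, map_zero]

theorem fourierLp_mem_hardySpace {n : ℤ} (hn : 0 ≤ n) : fourierLp (T := 1) 2 n ∈ hardySpace := by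
  intro m hm
  rw [fourierCoeff_fourierLp, Pi.single_eq_of_ne (by omega)]

theorem mulOp_mem_hardySpace {u : C(AddCircle (1 : ℝ), ℂ)} {F : ℂ → ℂ}
    (hF : ∀ z, ‖z‖ ≤ 1 → DifferentiableAt ℂ F z) (hu : ∀ t, u t = F (toCircle t))
    {f : L2Circle} (hf : f ∈ hardySpace) : mulOp u f ∈ hardySpace := by
  intro n hn
  obtain ⟨k, hk⟩ := Int.eq_ofNat_of_zero_le (neg_nonneg.mpr hn.le)
  have hk0 : k ≠ 0 := by omega
  rw [fourierCoeff_eq_inner]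
  refine toLp_inner_mulOp (g := fourier n) (G := fun z => z ^ k * F z)
    (fun z hz => (differentiableAt_id.pow k).mul (hF z hz)) (by simp [hk0]) (fun t => ?_) hf
  rw [← fourier_neg, hk, hu, fourier_eq_toCircle_zpow, zpow_natCast]

theorem mulOp_fourier_one_mem_hardySpace {f : L2Circle} (hf : f ∈ hardySpace) :
    mulOp (fourier 1) f ∈ hardySpace :=
  mulOp_mem_hardySpace (fun _ _ => differentiableAt_id) (fun _ => fourier_one) hf

theorem inner_star_of_mem_hardySpace {f g : L2Circle} (hf : f ∈ hardySpace)
    (hg : g ∈ hardySpace) :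
    inner ℂ g (star f) = conj (fourierCoeff g 0) * conj (fourierCoeff f 0) := by
  have hterm (n : ℤ) : inner ℂ g (fourierLp (T := 1) 2 n) * fourierCoeff (star f : L2Circle) n =
      conj (fourierCoeff g n) * conj (fourierCoeff f (-n)) := by
    rw [fourierCoeff_star, ← inner_conj_symm, fourierCoeff_eq_inner g]
  rw [← fourierBasis.tsum_inner_mul_inner g (star f)]
  simp only [coe_fourierBasis, ← fourierCoeff_eq_inner, hterm]
  rw [tsum_eq_single 0, neg_zero]
  intro n hn
  rcases lt_or_gt_of_ne hn with hneg | hpos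
  · rw [hg n hneg, map_zero, zero_mul]
  · rw [hf (-n) (by omega), map_zero, mul_zero]

/-- The backward shift `f ↦ (f - f(0)) / z`, extended to `L²` by the formula `z̄ f - f̂(0) z̄`. -/
def backwardShift : L2Circle →L[ℂ] L2Circle :=
  mulOp (fourier (-1)) - rankOne ℂ (fourierLp (T := 1) 2 (-1)) (fourierLp (T := 1) 2 0)

theorem backwardShift_apply (f : L2Circle) :
    backwardShift f = mulOp (fourier (-1)) f - fourierCoeff f 0 • fourierLp (T := 1) 2 (-1) := by
  rw [fourierCoeff_eq_inner]
  rfl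

theorem fourierCoeff_backwardShift (f : L2Circle) (n : ℤ) :
    fourierCoeff (backwardShift f) n = if n = -1 then 0 else fourierCoeff f (n + 1) := by
  rw [fourierCoeff_eq_inner, backwardShift_apply, inner_sub_right, inner_smul_right,
    ← fourierCoeff_eq_inner, ← fourierCoeff_eq_inner, fourierCoeff_mulOp_fourier,
    fourierCoeff_fourierLp, sub_neg_eq_add]
  split_ifs with hn
  · simp [hn]
  · simp [hn]

theorem backwardShift_mem_hardySpace {f : L2Circle} (hf : f ∈ hardySpace) :
    backwardShift f ∈ hardySpace := by
  intro n hn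
  rw [fourierCoeff_backwardShift]
  split_ifs with hn'
  · rfl
  · exact hf _ (by omega)

theorem fourierCoeff_iterate_backwardShift (f : L2Circle) (n k : ℕ) :
    fourierCoeff (backwardShift^[n] f) k = fourierCoeff f ((k + n : ℕ) : ℤ) := by
  induction n generalizing k with
  | zero => rfl
  | succ n ih =>
    rw [Function.iterate_succ_apply', fourierCoeff_backwardShift, if_neg (by omega),
      ← Nat.cast_succ, ih, Nat.succ_add_eq_add_succ]

theorem hasSum_sq_norm_fourierCoeff_of_mem_hardySpace {f : L2Circle} (hf : f ∈ hardySpace) :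
    HasSum (fun k : ℕ => ‖fourierCoeff f (k : ℤ)‖ ^ 2) (‖f‖ ^ 2) := by
  refine (Nat.cast_injective.hasSum_iff fun n hn => ?_).mpr (hasSum_sq_norm_fourierCoeff f)
  have hneg : n < 0 := by
    by_contra! hn'
    exact hn ⟨n.toNat, Int.toNat_of_nonneg hn'⟩
  rw [hf n hneg, norm_zero, zero_pow two_ne_zero]

theorem tendsto_iterate_backwardShift {f : L2Circle} (hf : f ∈ hardySpace) :
    Tendsto (fun n => backwardShift^[n] f) atTop (𝓝 0) := by
  have hmem (n : ℕ) : backwardShift^[n] f ∈ hardySpace :=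
    Set.MapsTo.iterate (s := (hardySpace : Set L2Circle))
      (fun _ => backwardShift_mem_hardySpace) n hf
  have hnorm (n : ℕ) : ∑' k : ℕ, ‖fourierCoeff f ((k + n : ℕ) : ℤ)‖ ^ 2 =
      ‖backwardShift^[n] f‖ ^ 2 := by
    simpa only [fourierCoeff_iterate_backwardShift] using
      (hasSum_sq_norm_fourierCoeff_of_mem_hardySpace (hmem n)).tsum_eq
  have htail := tendsto_sum_nat_add fun k : ℕ => ‖fourierCoeff f (k : ℤ)‖ ^ 2
  simp only [hnorm] at htail
  rw [tendsto_zero_iff_norm_tendsto_zero]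
  simpa using htail.sqrt

end HardySpace

namespace FiniteBlaschkeProduct

variable (α β : FiniteBlaschkeProduct)

section ModelSpace

variable {α}

theorem mem_modelSpace_iff {f : L2Circle} :
    f ∈ α.modelSpace ↔ f ∈ hardySpace ∧
      ∀ h ∈ hardySpace, inner ℂ (mulOp α.boundary h) f = 0 := by
  rw [modelSpace, Submodule.mem_inf, Submodule.mem_orthogonal]
  exact and_congr_right fun _ => Set.forall_mem_image

variable (α)

theorem mulOp_boundary_mem_hardySpace {h : L2Circle} (hh : h ∈ hardySpace) :
    mulOp α.boundary h ∈ hardySpace :=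
  mulOp_mem_hardySpace (fun _ hz => α.differentiableAt_eval hz) α.boundary_apply hh

/-- The denominator `∏ⱼ (1 - conj aⱼ z)` of `α`, as a function on the unit circle. -/
def denominator : C(AddCircle (1 : ℝ), ℂ) where
  toFun t := ∏ j, (1 - conj (α.zero j) * toCircle t)
  continuous_toFun := continuous_finsetProd _ fun _ _ =>
    continuous_const.sub (continuous_const.mul continuous_coe_toCircle)

theorem denominator_apply (t : AddCircle (1 : ℝ)) :
    α.denominator t = ∏ j, (1 - conj (α.zero j) * toCircle t) := rfl

theorem isUnit_denominator : IsUnit α.denominator :=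
  (ContinuousMap.isUnit_iff_forall_ne_zero _).mpr fun t => by
    rw [denominator_apply]
    exact Finset.prod_ne_zero_iff.mpr fun j _ => α.denom_ne_zero (Circle.norm_coe (toCircle t)).le j

theorem mulOp_denominator_mem_hardySpace {h : L2Circle} (hh : h ∈ hardySpace) :
    mulOp α.denominator h ∈ hardySpace :=
  mulOp_mem_hardySpace (F := fun z => ∏ j, (1 - conj (α.zero j) * z))
    (fun _ _ => by fun_prop) α.denominator_apply hh

theorem boundary_mul_denominator_apply (t : AddCircle (1 : ℝ)) :
    α.boundary t * α.denominator t = α.const * ∏ j, (toCircle t - α.zero j) := by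
  rw [boundary_apply, eval, denominator_apply, mul_assoc, ← Finset.prod_mul_distrib]
  congr 1
  exact Finset.prod_congr rfl fun j _ =>
    div_mul_cancel₀ _ (α.denom_ne_zero (Circle.norm_coe _).le j)

theorem star_denominator_mul_fourier_degree :
    star α.denominator * fourier (α.degree : ℤ) =
      conj α.const • (α.boundary * α.denominator) := by
  ext t
  have conj_factor_mul (j : Fin α.degree) :
      conj (1 - conj (α.zero j) * toCircle t) * toCircle t = toCircle t - α.zero j := by
    simp only [map_sub, map_one, map_mul, Complex.conj_conj]
    linear_combination (-α.zero j) * conj_toCircle_mul t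
  have conj_const_mul : conj α.const * α.const = 1 := by
    rw [Complex.conj_mul', α.norm_const, Complex.ofReal_one, one_pow]
  calc (star α.denominator * fourier (α.degree : ℤ) : C(AddCircle (1 : ℝ), ℂ)) t
      = (∏ j, conj (1 - conj (α.zero j) * toCircle t)) * (toCircle t : ℂ) ^ α.degree := by
        rw [ContinuousMap.mul_apply, ContinuousMap.star_apply, denominator_apply,
          RCLike.star_def, map_prod, fourier_eq_toCircle_zpow, zpow_natCast]
    _ = ∏ j, (toCircle t - α.zero j) := by
        simpa only [Finset.card_univ, Fintype.card_fin, conj_factor_mul] using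
          Finset.prod_mul_pow_card (s := Finset.univ) (b := (toCircle t : ℂ))
            (f := fun j => conj (1 - conj (α.zero j) * toCircle t))
    _ = (conj α.const • (α.boundary * α.denominator)) t := by
        rw [ContinuousMap.smul_apply, ContinuousMap.mul_apply, boundary_mul_denominator_apply,
          smul_eq_mul, ← mul_assoc, conj_const_mul, one_mul]

variable {α} in
theorem fourierCoeff_mulOp_denominator_eq_zero {f : L2Circle} (hf : f ∈ α.modelSpace) {n : ℤ}
    (hn : α.degree ≤ n) : fourierCoeff (mulOp α.denominator f) n = 0 := by
  have hstar : star α.denominator * fourier n =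
      α.boundary * (conj α.const • (α.denominator * fourier (n - α.degree))) := by
    rw [← add_sub_cancel (α.degree : ℤ) n, ← fourier_mul_fourier, ← mul_assoc,
      star_denominator_mul_fourier_degree, add_sub_cancel, smul_mul_assoc, mul_smul_comm,
      mul_assoc]
  rw [fourierCoeff_eq_inner, inner_mulOp_right, mulOp_fourierLp, hstar, ← mulOp_toLp, map_smul,
    ← mulOp_fourierLp]
  exact (mem_modelSpace_iff.mp hf).2 _ (hardySpace.smul_mem _
    (α.mulOp_denominator_mem_hardySpace (fourierLp_mem_hardySpace (by omega))))

theorem modelSpace_le_span :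
    α.modelSpace ≤ Submodule.span ℂ ((fun n : ℤ =>
      ContinuousMap.toLp 2 haarAddCircle ℂ (Ring.inverse α.denominator * fourier n)) ''
        Set.Ico 0 (α.degree : ℤ)) := by
  intro f hf
  have hsum := eq_sum_fourierLp_of_fourierCoeff_eq_zero (f := mulOp α.denominator f)
    (s := Finset.Ico 0 (α.degree : ℤ)) fun n hn => by
      rcases lt_or_ge n 0 with hneg | hnonneg
      · exact α.mulOp_denominator_mem_hardySpace hf.1 n hneg
      · exact fourierCoeff_mulOp_denominator_eq_zero hf
          (not_lt.mp fun hlt => hn (Finset.mem_Ico.mpr ⟨hnonneg, hlt⟩))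
  have hf_eq : f = mulOp (Ring.inverse α.denominator) (mulOp α.denominator f) := by
    rw [mulOp_mulOp, Ring.inverse_mul_cancel _ α.isUnit_denominator, mulOp_one]
  rw [hf_eq, hsum, map_sum]
  refine Submodule.sum_mem _ fun n hn => ?_
  rw [map_smul, mulOp_fourierLp]
  exact Submodule.smul_mem _ _ (Submodule.subset_span ⟨n, Finset.mem_Ico.mp hn, rfl⟩)

instance : FiniteDimensional ℂ α.modelSpace :=
  have := FiniteDimensional.span_of_finite ℂ ((Set.finite_Ico 0 (α.degree : ℤ)).image fun n =>
    ContinuousMap.toLp 2 haarAddCircle ℂ (Ring.inverse α.denominator * fourier n))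
  Submodule.finiteDimensional_of_le α.modelSpace_le_span

theorem modelSpace_le_range_toLp :
    α.modelSpace ≤ (ContinuousMap.toLp 2 haarAddCircle ℂ :
      C(AddCircle (1 : ℝ), ℂ) →L[ℂ] L2Circle).range := by
  refine α.modelSpace_le_span.trans (Submodule.span_le.mpr ?_)
  rintro _ ⟨n, -, rfl⟩
  exact ⟨_, rfl⟩

/-- The continuous representative of an element of `K_α`. It allows the product of an element of
`K_α` with an arbitrary symbol in `L²` to be written as `mulOp (continuousRep f) φ`. -/
def continuousRep : α.modelSpace →L[ℂ] C(AddCircle (1 : ℝ), ℂ) :=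
  LinearMap.toContinuousLinearMap
    ((LinearEquiv.ofInjective (ContinuousMap.toLp (E := ℂ) 2 haarAddCircle ℂ).toLinearMap
      (ContinuousMap.toLp_injective haarAddCircle)).symm.toLinearMap ∘ₗ
        Submodule.inclusion α.modelSpace_le_range_toLp)

variable {α}

theorem toLp_continuousRep (f : α.modelSpace) :
    ContinuousMap.toLp 2 haarAddCircle ℂ (α.continuousRep f) = (f : L2Circle) :=
  congrArg Subtype.val <| LinearEquiv.apply_symm_apply
    (LinearEquiv.ofInjective (ContinuousMap.toLp (E := ℂ) 2 haarAddCircle ℂ).toLinearMap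
      (ContinuousMap.toLp_injective haarAddCircle))
        ⟨(f : L2Circle), α.modelSpace_le_range_toLp f.2⟩

theorem coeFn_mulOp_continuousRep (f : α.modelSpace) (φ : L2Circle) :
    mulOp (α.continuousRep f) φ =ᵐ[haarAddCircle] fun t => φ t * (f : L2Circle) t := by
  filter_upwards [coeFn_mulOp (α.continuousRep f) φ,
    ContinuousMap.coeFn_toLp (p := 2) (𝕜 := ℂ) haarAddCircle (α.continuousRep f)] with t hφ hf
  rw [hφ, ← toLp_continuousRep f, hf, mul_comm]

end ModelSpace

section CompressedShift

theorem coe_kernel : (α.kernel : L2Circle) =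
    fourierLp (T := 1) 2 0 - conj (α.eval 0) • mulOp α.boundary (fourierLp (T := 1) 2 0) := by
  rw [mulOp_fourierLp, fourierLp, fourier_zero_eq_one, mul_one, ← map_smul, ← map_sub]
  rfl

variable {α}

theorem inner_kernel (f : α.modelSpace) :
    inner ℂ α.kernel f = fourierCoeff (f : L2Circle) 0 := by
  rw [Submodule.coe_inner, coe_kernel, inner_sub_left, inner_smul_left,
    (mem_modelSpace_iff.mp f.2).2 _ (fourierLp_mem_hardySpace le_rfl), mul_zero, sub_zero,
    fourierCoeff_eq_inner]

theorem backwardShift_mem_modelSpace {f : L2Circle} (hf : f ∈ α.modelSpace) :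
    backwardShift f ∈ α.modelSpace := by
  refine mem_modelSpace_iff.mpr ⟨backwardShift_mem_hardySpace hf.1, fun h hh => ?_⟩
  rw [backwardShift_apply, inner_sub_right, inner_smul_right,
    inner_fourierLp_right_of_mem_hardySpace (α.mulOp_boundary_mem_hardySpace hh) (by norm_num),
    inner_mulOp_right, star_fourier, neg_neg, mulOp_mulOp, mul_comm, ← mulOp_mulOp,
    (mem_modelSpace_iff.mp hf).2 _ (mulOp_fourier_one_mem_hardySpace hh), mul_zero, sub_zero]

theorem coe_adjoint_compressedShift_apply (f : α.modelSpace) :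
    (ContinuousLinearMap.adjoint α.compressedShift f : L2Circle) = backwardShift f := by
  suffices h : ContinuousLinearMap.adjoint α.compressedShift f =
      ⟨backwardShift f, backwardShift_mem_modelSpace f.2⟩ from congrArg Subtype.val h
  refine ext_inner_left ℂ fun g => ?_
  calc inner ℂ g (ContinuousLinearMap.adjoint α.compressedShift f)
      = inner ℂ (mulOp (fourier 1) (g : L2Circle)) (f : L2Circle) := by
        rw [ContinuousLinearMap.adjoint_inner_right]
        exact Submodule.inner_orthogonalProjectionOnto_eq_of_mem_right f _
    _ = inner ℂ (g : L2Circle) (backwardShift f) := by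
        rw [backwardShift_apply, inner_sub_right, inner_smul_right,
          inner_fourierLp_right_of_mem_hardySpace g.2.1 (by norm_num), mul_zero, sub_zero,
          inner_mulOp_left, star_fourier]
    _ = inner ℂ g (⟨backwardShift f, backwardShift_mem_modelSpace f.2⟩ : α.modelSpace) := rfl

variable (α)

theorem tendsto_iterate_adjoint_compressedShift (f : α.modelSpace) :
    Tendsto (fun n => (ContinuousLinearMap.adjoint α.compressedShift)^[n] f) atTop (𝓝 0) := by
  have hcoe (n : ℕ) : ((ContinuousLinearMap.adjoint α.compressedShift)^[n] f : L2Circle) =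
      backwardShift^[n] f :=
    Function.Semiconj.iterate_right coe_adjoint_compressedShift_apply n f
  rw [tendsto_subtype_rng]
  simpa only [hcoe, ZeroMemClass.coe_zero] using tendsto_iterate_backwardShift f.2.1

theorem norm_compressedShift_le_one : ‖α.compressedShift‖ ≤ 1 := by
  refine ContinuousLinearMap.opNorm_le_bound _ zero_le_one fun f => ?_
  rw [one_mul, Submodule.coe_norm f, ← norm_mulOp_of_norm_eq_one (g := fourier 1) fun t => by
    rw [fourier_one, Circle.norm_coe]]
  exact α.modelSpace.norm_orthogonalProjectionOnto_apply_le _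

theorem displacement_compressedShift_injective :
    Function.Injective (displacement β.compressedShift
      (ContinuousLinearMap.adjoint α.compressedShift)) :=
  displacement_injective β.norm_compressedShift_le_one α.tendsto_iterate_adjoint_compressedShift

theorem compressedShift_orthogonalProjectionOnto_mulOp_fourier_neg_one (u : L2Circle) :
    α.compressedShift (α.modelSpace.orthogonalProjectionOnto (mulOp (fourier (-1)) u)) =
      α.modelSpace.orthogonalProjectionOnto u - fourierCoeff u 0 • α.kernel := by
  refine ext_inner_left ℂ fun g => ?_
  rw [← ContinuousLinearMap.adjoint_inner_left, inner_sub_right,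
    inner_smul_right (E := α.modelSpace),
    Submodule.inner_orthogonalProjectionOnto_eq_of_mem_left,
    Submodule.inner_orthogonalProjectionOnto_eq_of_mem_left, coe_adjoint_compressedShift_apply,
    backwardShift_apply, inner_sub_left, inner_smul_left, ← fourierCoeff_eq_inner,
    fourierCoeff_mulOp_fourier, sub_self, inner_mulOp_left, star_fourier, mulOp_mulOp,
    fourier_mul_fourier, neg_neg, add_neg_cancel, fourier_zero_eq_one, mulOp_one,
    ← inner_conj_symm g α.kernel, inner_kernel, mul_comm]

theorem orthogonalProjectionOnto_star {h : L2Circle} (hh : h ∈ hardySpace) :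
    α.modelSpace.orthogonalProjectionOnto (star h) = conj (fourierCoeff h 0) • α.kernel := by
  refine ext_inner_left ℂ fun g => ?_
  rw [Submodule.inner_orthogonalProjectionOnto_eq_of_mem_left,
    inner_star_of_mem_hardySpace hh g.2.1, inner_smul_right, ← inner_conj_symm g α.kernel,
    inner_kernel, mul_comm]

theorem modifiedShift_eq (c : ℂ) :
    α.modifiedShift c = α.compressedShift + rankOne ℂ α.kernel (conj c • α.conjKernel) := by
  rw [modifiedShift, map_smulₛₗ, Complex.conj_conj]

end CompressedShift

section TruncatedToeplitz

/-- The truncated Toeplitz operator `f ↦ P_β (φ f)` with symbol `φ ∈ L²`. -/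
def toeplitz (φ : L2Circle) : α.modelSpace →L[ℂ] β.modelSpace :=
  β.modelSpace.orthogonalProjectionOnto ∘L (mulOpL ∘L α.continuousRep).flip φ

theorem toeplitz_apply (φ : L2Circle) (f : α.modelSpace) :
    toeplitz α β φ f = β.modelSpace.orthogonalProjectionOnto (mulOp (α.continuousRep f) φ) := rfl

theorem toeplitz_add (φ φ' : L2Circle) :
    toeplitz α β (φ + φ') = toeplitz α β φ + toeplitz α β φ' := by
  rw [toeplitz, map_add, ContinuousLinearMap.comp_add]
  rfl

variable {α β}

theorem coe_mem_asymTruncToeplitz_iff {A : α.modelSpace →L[ℂ] β.modelSpace} :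
    (A : α.modelSpace →ₗ[ℂ] β.modelSpace) ∈ asymTruncToeplitz α β ↔
      ∃ φ, A = toeplitz α β φ := by
  have toLp_eq {φ : L2Circle} {f : α.modelSpace}
      (h : MemLp (fun t => φ t * (f : L2Circle) t) 2 haarAddCircle) :
      h.toLp = mulOp (α.continuousRep f) φ :=
    Lp.ext (h.coeFn_toLp.trans (coeFn_mulOp_continuousRep f φ).symm)
  constructor
  · rintro ⟨-, φ, hφ⟩
    refine ⟨φ, ContinuousLinearMap.ext fun f => ?_⟩
    obtain ⟨hmem, hf⟩ := hφ f
    rw [toeplitz_apply, ← toLp_eq hmem, ← hf, ContinuousLinearMap.coe_coe]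
  · rintro ⟨φ, rfl⟩
    refine ⟨(toeplitz α β φ).continuous, φ, fun f => ?_⟩
    have hmem := (memLp_congr_ae (coeFn_mulOp_continuousRep f φ)).mp (Lp.memLp _)
    exact ⟨hmem, by rw [toLp_eq hmem, ContinuousLinearMap.coe_coe, toeplitz_apply]⟩

theorem continuousRep_adjoint_compressedShift (f : α.modelSpace) :
    α.continuousRep (ContinuousLinearMap.adjoint α.compressedShift f) =
      fourier (-1) * (α.continuousRep f - inner ℂ α.kernel f • 1) := by
  refine ContinuousMap.toLp_injective (p := 2) (𝕜 := ℂ) haarAddCircle ?_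
  rw [toLp_continuousRep, coe_adjoint_compressedShift_apply, backwardShift_apply, inner_kernel,
    mul_sub, mul_smul_comm, mul_one, map_sub, map_smul, ← mulOp_toLp, toLp_continuousRep]

theorem mulOp_continuousRep_adjoint_compressedShift (f : α.modelSpace) (φ : L2Circle) :
    mulOp (α.continuousRep (ContinuousLinearMap.adjoint α.compressedShift f)) φ =
      mulOp (fourier (-1)) (mulOp (α.continuousRep f) φ - inner ℂ α.kernel f • φ) := by
  rw [continuousRep_adjoint_compressedShift, ← mulOp_mulOp, ← mulOpL_apply (_ - _), map_sub,
    map_smul, sub_apply, smul_apply, mulOpL_apply, mulOpL_apply, mulOp_one]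

variable (α β)

theorem displacement_toeplitz (φ : L2Circle) :
    displacement β.compressedShift (ContinuousLinearMap.adjoint α.compressedShift)
        (toeplitz α β φ) =
      rankOne ℂ (β.modelSpace.orthogonalProjectionOnto φ - fourierCoeff φ 0 • β.kernel) α.kernel +
        rankOne ℂ β.kernel (α.modelSpace.orthogonalProjectionOnto (star φ)) := by
  ext1 f
  have fourierCoeff_zero : fourierCoeff
      (mulOp (α.continuousRep f) φ - inner ℂ α.kernel f • φ : L2Circle) 0 =
        inner ℂ (α.modelSpace.orthogonalProjectionOnto (star φ)) f -
          inner ℂ α.kernel f * fourierCoeff φ 0 := by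
    rw [fourierCoeff_eq_inner, inner_sub_right, inner_smul_right, ← fourierCoeff_eq_inner,
      ← fourierCoeff_eq_inner, fourierCoeff_zero_mulOp, toLp_continuousRep,
      Submodule.inner_orthogonalProjectionOnto_eq_of_mem_right]
  calc displacement β.compressedShift (ContinuousLinearMap.adjoint α.compressedShift)
        (toeplitz α β φ) f
      = toeplitz α β φ f - β.compressedShift
          (toeplitz α β φ (ContinuousLinearMap.adjoint α.compressedShift f)) := rfl
    _ = inner ℂ α.kernel f • β.modelSpace.orthogonalProjectionOnto φ +
          (inner ℂ (α.modelSpace.orthogonalProjectionOnto (star φ)) f -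
            inner ℂ α.kernel f * fourierCoeff φ 0) • β.kernel := by
        rw [toeplitz_apply, toeplitz_apply, mulOp_continuousRep_adjoint_compressedShift,
          compressedShift_orthogonalProjectionOnto_mulOp_fourier_neg_one, fourierCoeff_zero,
          map_sub β.modelSpace.orthogonalProjectionOnto,
          map_smul β.modelSpace.orthogonalProjectionOnto]
        abel
    _ = _ := by
        rw [add_apply, rankOne_apply, rankOne_apply]
        module

variable {α β}

theorem displacement_toeplitz_coe (ψ : β.modelSpace) :
    displacement β.compressedShift (ContinuousLinearMap.adjoint α.compressedShift)
        (toeplitz α β ψ) = rankOne ℂ ψ α.kernel := by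
  rw [displacement_toeplitz, α.orthogonalProjectionOnto_star ψ.2.1,
    Submodule.orthogonalProjectionOnto_mem_subspace_eq_self, rankOne_sub_smul_add_rankOne_conj_smul]

theorem displacement_toeplitz_star_coe (χ : α.modelSpace) :
    displacement β.compressedShift (ContinuousLinearMap.adjoint α.compressedShift)
        (toeplitz α β (star (χ : L2Circle))) = rankOne ℂ β.kernel χ := by
  rw [displacement_toeplitz, star_star, β.orthogonalProjectionOnto_star χ.2.1,
    Submodule.orthogonalProjectionOnto_mem_subspace_eq_self, fourierCoeff_star, neg_zero,
    sub_self]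
  ext1 f
  simp only [add_apply, rankOne_apply, smul_zero, zero_add]

theorem coe_mem_asymTruncToeplitz_iff_displacement_mem
    {A : α.modelSpace →L[ℂ] β.modelSpace} :
    (A : α.modelSpace →ₗ[ℂ] β.modelSpace) ∈ asymTruncToeplitz α β ↔
      displacement β.compressedShift (ContinuousLinearMap.adjoint α.compressedShift) A ∈
        rankOneSum ℂ α.kernel β.kernel := by
  rw [coe_mem_asymTruncToeplitz_iff]
  constructor
  · rintro ⟨φ, rfl⟩
    exact ⟨_, _, displacement_toeplitz α β φ⟩
  · rintro ⟨χ, ψ, hA⟩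
    refine ⟨ψ + star (χ : L2Circle), displacement_compressedShift_injective α β ?_⟩
    rw [hA, toeplitz_add, map_add, displacement_toeplitz_coe, displacement_toeplitz_star_coe]

end TruncatedToeplitz

end FiniteBlaschkeProduct

theorem mainTheorem1_general (α β : FiniteBlaschkeProduct) (u : α.modelSpace) (v : β.modelSpace)
    (A : α.modelSpace →ₗ[ℂ] β.modelSpace) :
    A ∈ FiniteBlaschkeProduct.asymTruncToeplitz α β ↔
      ∃ (χ : α.modelSpace) (ψ : β.modelSpace),
        A - ((β.compressedShift + rankOne ℂ β.kernel v : β.modelSpace →L[ℂ] β.modelSpace) :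
              β.modelSpace →ₗ[ℂ] β.modelSpace) ∘ₗ A ∘ₗ
            (ContinuousLinearMap.adjoint (α.compressedShift + rankOne ℂ α.kernel u) :
              α.modelSpace →ₗ[ℂ] α.modelSpace) =
          (rankOne ℂ ψ α.kernel : α.modelSpace →ₗ[ℂ] β.modelSpace) +
            (rankOne ℂ β.kernel χ : α.modelSpace →ₗ[ℂ] β.modelSpace) := by
  obtain ⟨A, rfl⟩ := LinearMap.toContinuousLinearMap.symm.surjective A
  have h_perturbed := displacement_add_rankOne_mem_rankOneSum_iff β.compressedShift
    α.compressedShift α.kernel u β.kernel v A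
  refine FiniteBlaschkeProduct.coe_mem_asymTruncToeplitz_iff_displacement_mem.trans
    (h_perturbed.symm.trans ?_)
  rw [mem_rankOneSum]
  exact exists₂_congr fun χ ψ => ContinuousLinearMap.coe_injective.eq_iff.symm

end

theorem mainTheorem1 (α β : FiniteBlaschkeProduct) (a b : ℂ)
    (A : α.modelSpace →ₗ[ℂ] β.modelSpace) :
    A ∈ FiniteBlaschkeProduct.asymTruncToeplitz α β ↔
      ∃ (χ : α.modelSpace) (ψ : β.modelSpace),
        A - (β.modifiedShift b : β.modelSpace →ₗ[ℂ] β.modelSpace) ∘ₗ A ∘ₗ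
            (ContinuousLinearMap.adjoint (α.modifiedShift a) :
              α.modelSpace →ₗ[ℂ] α.modelSpace) =
          (InnerProductSpace.rankOne ℂ ψ α.kernel : α.modelSpace →ₗ[ℂ] β.modelSpace) +
            (InnerProductSpace.rankOne ℂ β.kernel χ : α.modelSpace →ₗ[ℂ] β.modelSpace) := by
  simp only [FiniteBlaschkeProduct.modifiedShift_eq]
  exact mainTheorem1_general α β _ _ A
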